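/- Let $\Omega\subset\mathbb{R}^2$ be a compact convex set with nonempty interior (for example a convex polygon) that contains the origin, which serves as its reference point, and let $D$ be its diameter. Let $\varhexagon_0$ be the closed regular hexagon with centre $0$, diameter $2$ and two vertices on the $y$-axis. For $m,n\in\mathbb{Z}$ put $\overline{x}_{mn}=m(\sqrt3,0)+n(\tfrac{\sqrt3}{2},\tfrac32)$ and $$T_{mn}=\{(x,y,\theta)\mid \theta\in[0,\tfrac{\pi}{3}],\ (x,y)\in R(\pi+\theta)\Omega+\overline{x}_{mn}+\varhexagon_0\},$$ where $R(\alpha)$ is the rotation by $\alpha$ about the origin and $+$ is the Minkowski sum. Consider the finite family $\mathcal{T}$ of those $T_{mn}$ for which $|\overline{x}_{mn}|\le D+3$. The interior and the boundary $\partial T$ of a body $T\in\mathcal{T}$ are taken relative to $\mathbb{R}^2\times[0,\frac{\pi}{3}]$, so that $\partial T$ is the surface swept by the boundaries of the planar Minkowski sums. For a point $q\in\mathbb{R}^2\times[0,\frac{\pi}{3}]$ let $N(q)$ be the number of bodies $T\in\mathcal{T}$ whose interior contains $q$. Let $P_0=\varhexagon_0\times[0,\frac{\pi}{3}]$, and let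 $\partial P_0$ be its boundary in $\mathbb{R}^3$. Then for every $p\in P_0$ there is a point $q\in P_0$ with $N(q)\le N(p)$ that lies on three different surfaces of the set $\{\partial T\mid T\in\mathcal{T}\}\cup\{\partial P_0\}$; more precisely, either 1. $q\in\partial T_1\cap\partial T_2\cap\partial T_3$ for three different bodies $T_1,T_2,T_3\in\mathcal{T}$, or 2. $q\in\partial T_1\cap\partial T_2\cap\partial P_0$ for two different bodies $T_1,T_2\in\mathcal{T}$. -/

import Mathlib

open scoped Pointwise

noncomputable section

namespace HexCover

/-- The Euclidean plane. -/
abbrev Plane : Type := EuclideanSpace ℝ (Fin 2)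

/-- Positions and orientations `(x, y, θ)` with `(x, y)` in the plane and `θ ∈ [0, π/3]`,
with its usual topology (the subspace topology from three-dimensional space). -/
abbrev Config : Type := Plane × Set.Icc (0 : ℝ) (Real.pi / 3)

/-- `R(θ)`: the counterclockwise rotation of the plane by the angle `θ` about the origin. -/
def rot (θ : ℝ) (z : Plane) : Plane :=
  !₂[Real.cos θ * z 0 - Real.sin θ * z 1, Real.sin θ * z 0 + Real.cos θ * z 1]

/-- The canonical hexagon: the closed regular hexagon of diameter `2` centred at the origin
with two of its vertices on the `y`-axis. -/
def hexagon : Set Plane :=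
  convexHull ℝ {!₂[0, 1], !₂[√3 / 2, 1 / 2], !₂[√3 / 2, -(1 / 2)],
    !₂[0, -1], !₂[-(√3 / 2), -(1 / 2)], !₂[-(√3 / 2), 1 / 2]}

/-- The hexagon of the honeycomb that is centred at `v`. -/
def hexagonAt (v : Plane) : Set Plane := {v} + hexagon

/-- The point `m (√3, 0) + n (√3/2, 3/2)` of the hexagonal lattice. -/
def latticePoint (m n : ℤ) : Plane :=
  (m : ℝ) • !₂[√3, 0] + (n : ℝ) • !₂[√3 / 2, 3 / 2]

/-- The swept Minkowski sum of `Ω` and the hexagon centred at `v`: all `(x, y, θ)` with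
`(x, y) ∈ R(π + θ) Ω + hexagonAt v` and `θ ∈ [0, π/3]`. -/
def body (Ω : Set Plane) (v : Plane) : Set Config :=
  {q | q.1 ∈ rot (Real.pi + (q.2 : ℝ)) '' Ω + hexagonAt v}

/-- The family of the swept bodies of all lattice points in the ball of radius `D + 3` about
the origin, where `D` is the diameter of `Ω`. -/
def bodies (Ω : Set Plane) : Set (Set Config) :=
  {T | ∃ m n : ℤ, latticePoint m n ∈ Metric.closedBall (0 : Plane) (Metric.diam Ω + 3) ∧
    T = body Ω (latticePoint m n)}

/-- The set of the bodies that have `q` in their interior. The interior is taken in `Config`,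
so orientations `0` and `π/3` are not lost. -/
def Q (Ω : Set Plane) (q : Config) : Set (Set Config) :=
  {T | T ∈ bodies Ω ∧ q ∈ interior T}

/-- The number of bodies that have `q` in their interior. -/
def N (Ω : Set Plane) (q : Config) : ℕ∞ := (Q Ω q).encard

/-- The boundary surfaces of the bodies. The frontier is taken in `Config`; it consists of the
surfaces swept by the boundaries of the planar Minkowski sums, without the flat caps at
`θ = 0` and `θ = π/3`. -/
def bodySurfaces (Ω : Set Plane) : Set (Set Config) :=
  {S | ∃ T ∈ bodies Ω, S = frontier T}

/-- The hexagonal prism. -/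
def prism : Set Config := {q | q.1 ∈ hexagon}

/-- The boundary of the hexagonal prism `hexagon × [0, π/3]` as a body in three-dimensional
space; it consists of the six side faces and of the two hexagonal faces at `θ = 0, π/3`. -/
def prismBoundary : Set Config :=
  {q | (q.1, (q.2 : ℝ)) ∈ frontier (hexagon ×ˢ Set.Icc (0 : ℝ) (Real.pi / 3))}

end HexCover

end

/-!
Since `Ω` contains the origin, a body whose lattice point has norm larger than `D + 3` does not
meet the prism. On the prism, the covering number `N` therefore agrees with the covering number by
the bodies of all lattice points, which is defined on all of `Config`, is periodic, and is lower
semicontinuous because the family is locally finite. The hexagon represents every class of the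
plane modulo the lattice, so the side faces of the prism play no role.

Let `A` be the closed set of the points whose covering number is at most that of `p`, and let `θ`
be the largest orientation that occurs in `A`; it exists since `A` is periodic and closed. In the
slice at `θ`, the bodies are translates of one convex body. By `exists_crossing`, the slice of `A`
contains a point `q` on the boundaries of two bodies that overlap in this slice, or a point on
three boundaries: otherwise `A` would contain, by a connectedness argument, the whole boundary
curve of some body, and hence the points in which this curve crosses the boundary of an
overlapping neighbour. If only two boundaries pass through `q` and `θ < π / 3`, then pushing `q`
away from a common interior point of the two slices and slightly increasing the orientation does
not increase the covering number (`exists_gt_encard_interiorIndices_le`), which contradicts the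
choice of `θ`. So either a third boundary passes through `q`, or `θ = π / 3` and a translate of
`q` lies on the top face of the prism.

The interiors and frontiers of the bodies in `Config` are those of the planar slices, because an
interior point of a slice is the sum of a rotated interior point of `Ω` and a point of a hexagon
(`exists_mem_interior_of_mem_interior_slice`), a condition that is stable under small rotations.
-/

noncomputable section

namespace HexCover

open Set Filter Topology

/-! ### Covering numbers of locally finite families -/

/-- The indices of the members of the family `T` that have `q` in their interior. -/
def interiorIndices {ι X : Type*} [TopologicalSpace X] (T : ι → Set X) (q : X) : Set ι :=
  {i | q ∈ interior (T i)}

section LocallyFinite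

variable {ι X : Type*} [TopologicalSpace X] {T : ι → Set X}

lemma eventually_interiorIndices_subset (hT : LocallyFinite T) (q : X) :
    ∀ᶠ y in 𝓝 q, interiorIndices T q ⊆ interiorIndices T y := by
  have hfin : (interiorIndices T q).Finite :=
    (hT.point_finite q).subset fun i hi => interior_subset (s := T i) hi
  exact hfin.eventually_all.2 fun i hi => isOpen_interior.mem_nhds hi

/-- Near `q`, a point that avoids the interiors of the members through whose frontier `q` passes
is in no more interiors than `q`. -/
lemma eventually_interiorIndices_subset_of_frontier (hT : LocallyFinite T)
    (hc : ∀ i, IsClosed (T i)) (q : X) :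
    ∀ᶠ y in 𝓝 q, (∀ i, q ∈ frontier (T i) → y ∉ interior (T i)) →
      interiorIndices T y ⊆ interiorIndices T q := by
  filter_upwards [hT.eventually_subset hc q] with y hy h i hi
  by_contra hq
  have hqi : q ∈ frontier (T i) := ⟨subset_closure (hy (interior_subset (s := T i) hi)), hq⟩
  exact h i hqi hi

/-- The covering number is lower semicontinuous. -/
lemma isClosed_encard_interiorIndices_le (hT : LocallyFinite T) (k : ℕ∞) :
    IsClosed {q | (interiorIndices T q).encard ≤ k} := by
  refine isClosed_of_closure_subset fun q hq => ?_
  obtain ⟨y, hy, hyk⟩ := (mem_closure_iff_frequently.1 hq).and_eventually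
    (eventually_interiorIndices_subset hT q) |>.exists
  exact (encard_le_encard hyk).trans hy

end LocallyFinite

lemma _root_.IsPreconnected.inter_frontier_nonempty_of_isClosed {X : Type*} [TopologicalSpace X]
    {s u : Set X} (hs : IsPreconnected s) (hu : IsClosed u) (h1 : (s ∩ u).Nonempty)
    (h2 : (s ∩ uᶜ).Nonempty) : (s ∩ frontier u).Nonempty := by
  rw [frontier_eq_closure_inter_closure, hu.closure_eq]
  refine isPreconnected_closed_iff.1 hs _ _ hu isClosed_closure (fun x _ => ?_) h1
    (h2.mono (inter_subset_inter_right _ subset_closure))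
  exact (em (x ∈ u)).imp id fun h => subset_closure h

/-! ### Frontiers of convex bodies and of their translates -/

section Convex

variable {E : Type*} [NormedAddCommGroup E]

lemma eventually_add_smul_mem [NormedSpace ℝ E] {U : Set E} {x : E} (hU : U ∈ 𝓝 x) (u : E) :
    ∀ᶠ t : ℝ in 𝓝[>] 0, x + t • u ∈ U := by
  have h : Tendsto (fun t : ℝ => x + t • u) (𝓝 0) (𝓝 x) := by
    have : Continuous fun t : ℝ => x + t • u := by fun_prop
    simpa using this.tendsto 0
  exact (h.mono_left nhdsWithin_le_nhds).eventually hU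

/-- A boundary point pushed away from an interior point leaves the convex set. -/
lemma add_smul_sub_notMem_of_notMem_interior [NormedSpace ℝ E] {C : Set E} (hC : Convex ℝ C)
    {c x : E} (hc : c ∈ interior C) (hx : x ∉ interior C) {t : ℝ} (ht : 0 < t) :
    x + t • (x - c) ∉ C := by
  intro h
  apply hx
  have h1 : (0 : ℝ) < 1 + t := by positivity
  have h2 : x = (t / (1 + t)) • c + (1 / (1 + t)) • (x + t • (x - c)) := by
    match_scalars <;> field_simp
    ring
  rw [h2]
  exact hC.combo_interior_self_mem_interior hc h (by positivity) (by positivity)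
    (by field_simp; ring)

variable [InnerProductSpace ℝ E]

/-- The boundary point is one that maximizes the scalar product with `w`. -/
lemma exists_mem_frontier_add_notMem {C : Set E} (hC : IsCompact C) (hne : C.Nonempty) {w : E}
    (hw : w ≠ 0) : ∃ y ∈ frontier C, y + w ∉ C := by
  obtain ⟨y, hy, hmax⟩ := hC.exists_isMaxOn hne
    (f := fun z => inner ℝ w z) (by fun_prop)
  have key : ∀ t : ℝ, 0 < t → y + t • w ∉ C := by
    intro t ht h
    have h1 := hmax h
    simp only [mem_ofPred_eq, inner_add_right, inner_smul_right] at h1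
    have h2 : 0 < inner ℝ w w := real_inner_self_pos.2 hw
    nlinarith [mul_pos ht h2]
  refine ⟨y, ⟨subset_closure hy, fun hi => ?_⟩, by simpa using key 1 one_pos⟩
  obtain ⟨t, ht, ht0⟩ := ((eventually_add_smul_mem (mem_interior_iff_mem_nhds.1 hi) w).and
    self_mem_nhdsWithin).exists
  exact key t ht0 ht

lemma isPreconnected_frontier_of_convex (hrank : 1 < Module.rank ℝ E) {C : Set E}
    (hconv : Convex ℝ C) (hcomp : IsCompact C) (hne : (interior C).Nonempty) :
    IsPreconnected (frontier C) := by
  obtain ⟨h, -, -, hf⟩ :=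
    exists_homeomorph_image_interior_closure_frontier_eq_unitBall hconv hne hcomp.isBounded
  have h1 : frontier C = h.symm '' Metric.sphere 0 1 := by
    rw [← hf, ← image_comp]; simp
  rw [h1]
  exact (isPreconnected_sphere hrank 0 1).image _ h.symm.continuous.continuousOn

/-- The boundaries of two overlapping translates of a convex body intersect. -/
lemma frontier_inter_frontier_nonempty (hrank : 1 < Module.rank ℝ E) {C D : Set E} {w : E}
    (hw : w ≠ 0) (hCD : ∀ x, x ∈ D ↔ x - w ∈ C)
    (hC : Convex ℝ C) (hCc : IsCompact C) (hD : Convex ℝ D) (hDc : IsCompact D)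
    (hint : (interior C ∩ interior D).Nonempty) :
    (frontier C ∩ frontier D).Nonempty := by
  obtain ⟨c, hcC, hcD⟩ := hint
  obtain ⟨y, hy, hyw⟩ := exists_mem_frontier_add_notMem hCc ⟨c, interior_subset hcC⟩
    (neg_ne_zero.2 hw)
  obtain ⟨z, hz, hzw⟩ := exists_mem_frontier_add_notMem hDc ⟨c, interior_subset hcD⟩ hw
  have hyC := hCc.isClosed.frontier_subset hy
  have h1 : (C ∩ frontier D).Nonempty :=
    hC.isPreconnected.inter_frontier_nonempty_of_isClosed hDc.isClosed
      ⟨c, interior_subset hcC, interior_subset hcD⟩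
      ⟨y, hyC, fun h => hyw (by simpa [sub_eq_add_neg] using (hCD y).1 h)⟩
  obtain ⟨x, hx⟩ := (isPreconnected_frontier_of_convex hrank hD hDc
    ⟨c, hcD⟩).inter_frontier_nonempty_of_isClosed hCc.isClosed (by rwa [inter_comm] at h1)
      ⟨z, hz, fun h => hzw ((hCD _).2 (by simpa using h))⟩
  exact ⟨x, hx.2, hx.1⟩

/-- In a locally finite family of convex bodies, the covering number of any point `x₀` is attained
or undercut at a crossing of two boundaries, where either the two bodies overlap or a third
boundary passes. If there were no such crossing, the points covered at most as often as `x₀` would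
form a relatively clopen part of each boundary, hence would contain all of some boundary (they
meet one, as they would otherwise form a clopen part of the whole space), in particular the
crossing provided by `hcross`. -/
theorem exists_crossing (hrank : 1 < Module.rank ℝ E) {ι : Type*} [Nonempty ι] {C : ι → Set E}
    (hlf : LocallyFinite C) (hconv : ∀ i, Convex ℝ (C i)) (hcomp : ∀ i, IsCompact (C i))
    (hne : ∀ i, (interior (C i)).Nonempty)
    (hcross : ∀ i, ∃ j, i ≠ j ∧ (frontier (C i) ∩ frontier (C j)).Nonempty ∧
      (interior (C i) ∩ interior (C j)).Nonempty) (x₀ : E) :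
    ∃ x, (interiorIndices C x).encard ≤ (interiorIndices C x₀).encard ∧ ∃ i j, i ≠ j ∧
      x ∈ frontier (C i) ∧ x ∈ frontier (C j) ∧
      ((interior (C i) ∩ interior (C j)).Nonempty ∨
        ∃ l, i ≠ l ∧ j ≠ l ∧ x ∈ frontier (C l)) := by
  by_contra! H
  set A : Set E := {x | (interiorIndices C x).encard ≤ (interiorIndices C x₀).encard} with hA
  have hclosed : IsClosed A := isClosed_encard_interiorIndices_le hlf _
  have hev := eventually_interiorIndices_subset_of_frontier hlf fun i => (hcomp i).isClosed
  -- Along a boundary, the number of interiors does not increase near a touching point.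
  have hopen : ∀ i, ∀ x ∈ A, x ∈ frontier (C i) → ∀ᶠ y in 𝓝 x, y ∈ frontier (C i) → y ∈ A := by
    intro i x hx hxi
    filter_upwards [hev x] with y hy hyi
    refine (encard_le_encard (hy fun l hl hyl => ?_)).trans hx
    by_cases hil : i = l
    · subst hil; exact hyi.2 hyl
    · have h1 : y ∈ closure (interior (C i)) := by
        rw [(hconv i).closure_interior_eq_closure_of_nonempty_interior (hne i)]
        exact hyi.1
      obtain ⟨z, hz1, hz2⟩ := mem_closure_iff.1 h1 _ isOpen_interior hyl
      have h2 := (H x hx i l hil hxi hl).1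
      exact (h2 ▸ (⟨hz2, hz1⟩ : z ∈ interior (C i) ∩ interior (C l)) : z ∈ (∅ : Set E))
  have hdisj : ∀ i, ∀ x ∈ A, x ∉ frontier (C i) := by
    intro i x hx hxi
    have hpre : PreconnectedSpace (frontier (C i)) :=
      isPreconnected_iff_preconnectedSpace.1
        (isPreconnected_frontier_of_convex hrank (hconv i) (hcomp i) (hne i))
    have hclopen : IsClopen {y : frontier (C i) | (y : E) ∈ A} := by
      refine ⟨hclosed.preimage continuous_subtype_val, isOpen_iff_mem_nhds.2 fun y hy => ?_⟩
      filter_upwards [continuous_subtype_val.continuousAt.eventually (hopen i y hy y.2)] with z hz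
      exact hz z.2
    have huniv := hclopen.eq_univ ⟨⟨x, hxi⟩, hx⟩
    obtain ⟨j, hij, ⟨y, hyi, hyj⟩, hne'⟩ := hcross i
    have hyA : y ∈ A := (huniv ▸ mem_univ _ : (⟨y, hyi⟩ : frontier (C i)) ∈
      {y : frontier (C i) | (y : E) ∈ A})
    exact hne'.ne_empty (H y hyA i j hij hyi hyj).1
  have hclopen : IsClopen A := by
    refine ⟨hclosed, isOpen_iff_mem_nhds.2 fun x hx => ?_⟩
    filter_upwards [hev x] with y hy
    exact (encard_le_encard (hy fun i hi => absurd hi (hdisj i x hx))).trans hx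
  have huniv := hclopen.eq_univ ⟨x₀, le_refl (interiorIndices C x₀).encard⟩
  obtain ⟨j, -, ⟨y, hy, -⟩, -⟩ := hcross (Classical.arbitrary ι)
  exact hdisj _ y (huniv ▸ mem_univ y) hy

end Convex

/-! ### Rotations, the lattice and the hexagon -/

/-- The rotation `rot α` as a linear map. -/
def rotLinear (α : ℝ) : Plane →ₗ[ℝ] Plane where
  toFun := rot α
  map_add' x y := by ext i; fin_cases i <;> simp [rot] <;> ring
  map_smul' c x := by ext i; fin_cases i <;> simp [rot] <;> ring

lemma rotLinear_apply (α : ℝ) (z : Plane) : rotLinear α z = rot α z := rfl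

lemma norm_rot (α : ℝ) (z : Plane) : ‖rot α z‖ = ‖z‖ := by
  rw [EuclideanSpace.norm_eq, EuclideanSpace.norm_eq]
  congr 1
  simp only [rot, Fin.sum_univ_two, Real.norm_eq_abs, sq_abs, PiLp.toLp_apply,
    Matrix.cons_val_zero, Matrix.cons_val_one, Matrix.cons_val_fin_one]
  linear_combination (z 0 ^ 2 + z 1 ^ 2) * Real.sin_sq_add_cos_sq α

lemma rot_neg_rot (α : ℝ) (z : Plane) : rot (-α) (rot α z) = z := by
  ext i
  fin_cases i <;> simp [rot]
  · linear_combination z 0 * Real.sin_sq_add_cos_sq α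
  · linear_combination z 1 * Real.sin_sq_add_cos_sq α

lemma rot_rot_neg (α : ℝ) (z : Plane) : rot α (rot (-α) z) = z := by
  simpa using rot_neg_rot (-α) z

@[fun_prop]
lemma continuous_rot {X : Type*} [TopologicalSpace X] {f : X → ℝ} {g : X → Plane}
    (hf : Continuous f) (hg : Continuous g) : Continuous fun x => rot (f x) (g x) := by
  refine (PiLp.continuous_toLp 2 _).comp (continuous_pi fun i => ?_)
  fin_cases i <;> simp <;> fun_prop

/-- The lattice point with the given pair of coordinates. -/
def lat (i : ℤ × ℤ) : Plane := latticePoint i.1 i.2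

lemma lat_apply_zero (i : ℤ × ℤ) : lat i 0 = √3 * (i.1 + i.2 / 2) := by
  simp [lat, latticePoint]; ring

lemma lat_apply_one (i : ℤ × ℤ) : lat i 1 = 3 / 2 * i.2 := by
  simp [lat, latticePoint]; ring

lemma lat_sub (i j : ℤ × ℤ) : lat (i - j) = lat i - lat j := by
  ext k
  fin_cases k
  · simp only [Fin.zero_eta, PiLp.sub_apply, lat_apply_zero, Prod.fst_sub, Prod.snd_sub]
    push_cast; ring
  · simp only [Fin.mk_one, PiLp.sub_apply, lat_apply_one, Prod.snd_sub]
    push_cast; ring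

lemma finite_norm_lat_le (M : ℝ) : {i | ‖lat i‖ ≤ M}.Finite := by
  refine (Set.finite_Icc ((-⌈2 * M⌉, -⌈2 * M⌉) : ℤ × ℤ) (⌈2 * M⌉, ⌈2 * M⌉)).subset
    fun i (hi : ‖lat i‖ ≤ M) => ?_
  have h0 := (PiLp.norm_apply_le (lat i) 0).trans hi
  have h1 := (PiLp.norm_apply_le (lat i) 1).trans hi
  rw [lat_apply_zero, Real.norm_eq_abs, abs_mul, abs_of_pos (by positivity : 0 < √3)] at h0
  rw [lat_apply_one, Real.norm_eq_abs, abs_le] at h1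
  have hs : 1 ≤ √3 := Real.one_le_sqrt.2 (by norm_num)
  have h2 : |(i.1 : ℝ) + i.2 / 2| ≤ M := by
    nlinarith [abs_nonneg ((i.1 : ℝ) + i.2 / 2)]
  rw [abs_le] at h2
  have hc := Int.le_ceil (2 * M)
  simp only [mem_Icc, Prod.le_def]
  refine ⟨⟨?_, ?_⟩, ?_, ?_⟩ <;> · rify; linarith

lemma lat_injective : Function.Injective lat := by
  intro i j h
  have h0 := congrArg (fun z : Plane => z 0) h
  have h1 := congrArg (fun z : Plane => z 1) h
  simp only [lat_apply_zero, lat_apply_one] at h0 h1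
  have hs : √3 ≠ 0 := by positivity
  have h2 : (i.2 : ℝ) = j.2 := by linarith
  have h3 : (i.1 : ℝ) = j.1 := by
    have := mul_left_cancel₀ hs h0
    linarith
  exact Prod.ext (by exact_mod_cast h3) (by exact_mod_cast h2)

lemma isCompact_hexagon : IsCompact hexagon :=
  Set.Finite.isCompact_convexHull ℝ (by simp)

lemma convex_hexagon : Convex ℝ hexagon := convex_convexHull ℝ _

lemma norm_le_one_of_mem_hexagon {h : Plane} (hh : h ∈ hexagon) : ‖h‖ ≤ 1 := by
  have h3 : √3 ^ 2 = 3 := Real.sq_sqrt (by norm_num)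
  have key : hexagon ⊆ Metric.closedBall (0 : Plane) 1 := by
    refine convexHull_min ?_ (convex_closedBall _ _)
    intro z hz
    rw [mem_closedBall_zero_iff, EuclideanSpace.norm_eq, Real.sqrt_le_iff]
    refine ⟨zero_le_one, ?_⟩
    simp only [mem_insert_iff, mem_singleton_iff] at hz
    rcases hz with rfl | rfl | rfl | rfl | rfl | rfl <;>
      simp [Fin.sum_univ_two, div_pow] <;> norm_num
  simpa using key hh

/-- The part of the hexagon on or to the right of the vertical axis, by its side lines: a point
lies on a vertical chord whose ends lie on two sides. -/
lemma mem_hexagon_of_nonneg {z : Plane} (h0 : 0 ≤ z 0) (h1 : z 0 ≤ √3 / 2)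
    (h2 : |z 1| ≤ 1 - z 0 / √3) : z ∈ hexagon := by
  have hs : 0 < √3 := by positivity
  have hv : ∀ a b, !₂[a, b] ∈ ({!₂[0, 1], !₂[√3 / 2, 1 / 2], !₂[√3 / 2, -(1 / 2)],
    !₂[0, -1], !₂[-(√3 / 2), -(1 / 2)], !₂[-(√3 / 2), 1 / 2]} : Set Plane) →
    !₂[a, b] ∈ hexagon := fun a b h => subset_convexHull ℝ _ h
  have hc : 0 < 1 - z 0 / √3 := by
    have : z 0 / √3 ≤ 1 / 2 := by rw [div_le_iff₀ hs]; linarith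
    linarith
  set s := 2 * z 0 / √3 with hsdef
  have hs0 : 0 ≤ s := by positivity
  have hs1 : s ≤ 1 := by rw [hsdef, div_le_one hs]; linarith
  have hsz : s * √3 = 2 * z 0 := by rw [hsdef]; field_simp
  have hz : z 0 / √3 = s / 2 := by rw [hsdef]; ring
  have up : !₂[z 0, 1 - z 0 / √3] ∈ hexagon := by
    have := convex_hexagon (hv 0 1 (by simp)) (hv (√3 / 2) (1 / 2) (by simp))
      (sub_nonneg.2 hs1) hs0 (by ring)
    convert this using 1
    ext k; fin_cases k <;> simp
    · linarith
    · linarith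
  have down : !₂[z 0, -(1 - z 0 / √3)] ∈ hexagon := by
    have := convex_hexagon (hv 0 (-1) (by simp)) (hv (√3 / 2) (-(1 / 2)) (by simp))
      (sub_nonneg.2 hs1) hs0 (by ring)
    convert this using 1
    ext k; fin_cases k <;> simp
    · linarith
    · linarith
  set c := 1 - z 0 / √3 with hcdef
  obtain ⟨h3, h4⟩ := abs_le.1 h2
  have := convex_hexagon up down (a := (c + z 1) / (2 * c)) (b := (c - z 1) / (2 * c))
    (div_nonneg (by linarith) (by linarith)) (div_nonneg (by linarith) (by linarith))
    (by field_simp; ring)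
  convert this using 1
  ext k; fin_cases k <;> simp <;> field_simp <;> ring

lemma neg_mem_hexagon {z : Plane} (hz : z ∈ hexagon) : -z ∈ hexagon := by
  rw [hexagon, ← Set.mem_neg, ← convexHull_neg]
  refine convexHull_mono ?_ hz
  intro y hy
  simp only [mem_insert_iff, mem_singleton_iff] at hy
  have key : ∀ a b : ℝ, -(!₂[a, b] : Plane) = !₂[-a, -b] := fun a b => by
    ext k; fin_cases k <;> simp
  rcases hy with rfl | rfl | rfl | rfl | rfl | rfl <;> simp [key]

lemma mem_hexagon {z : Plane} (h1 : |z 0| ≤ √3 / 2) (h2 : |z 1| + |z 0| / √3 ≤ 1) :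
    z ∈ hexagon := by
  rcases le_total 0 (z 0) with h | h
  · rw [abs_of_nonneg h] at h1 h2
    exact mem_hexagon_of_nonneg h h1 (by linarith)
  · rw [abs_of_nonpos h] at h1 h2
    rw [← neg_neg z]
    exact neg_mem_hexagon (mem_hexagon_of_nonneg (by simpa using h) (by simpa using h1)
      (by simp only [PiLp.neg_apply, abs_neg]; linarith))

lemma zero_mem_interior_hexagon : (0 : Plane) ∈ interior hexagon := by
  rw [mem_interior_iff_mem_nhds]
  filter_upwards [Metric.ball_mem_nhds (0 : Plane) (by norm_num : (0 : ℝ) < 1 / 2)] with z hz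
  rw [mem_ball_zero_iff] at hz
  have h0 := (PiLp.norm_apply_le z 0).trans hz.le
  have h1 := (PiLp.norm_apply_le z 1).trans hz.le
  rw [Real.norm_eq_abs] at h0 h1
  have hs : 1 ≤ √3 := Real.one_le_sqrt.2 (by norm_num)
  refine mem_hexagon (by linarith) ?_
  have : |z 0| / √3 ≤ |z 0| := div_le_self (abs_nonneg _) hs
  linarith

/-- The honeycomb covers the plane. Rows of the lattice are `3 / 2` apart; in the
rectangle around the nearest point of the nearest row, the corners outside its hexagon belong to
hexagons of the two adjacent rows. -/
lemma exists_sub_lat_mem_hexagon (x : Plane) : ∃ i, x - lat i ∈ hexagon := by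
  have hs : 0 < √3 := by positivity
  set n := round (x 1 / (3 / 2)) with hn
  set m := round (x 0 / √3 - n / 2) with hm
  have h1 := abs_le.1 (abs_sub_round (x 1 / (3 / 2)))
  have h0 := abs_le.1 (abs_sub_round (x 0 / √3 - n / 2))
  rw [← hn] at h1
  rw [← hm] at h0
  -- `a` and `b` are the coordinates relative to the lattice point, `a` in units of `√3`.
  set a := x 0 / √3 - n / 2 - m with ha
  set b := x 1 - 3 / 2 * n with hb
  have hb0 : -(3 / 4) ≤ b ∧ b ≤ 3 / 4 := by
    constructor <;> · rw [hb]; linarith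
  have key : ∀ k l : ℤ, |a - k - l / 2| ≤ 1 / 2 → |b - 3 / 2 * l| + |a - k - l / 2| ≤ 1 →
      ∃ i, x - lat i ∈ hexagon := by
    intro k l h2 h3
    refine ⟨(m + k, n + l), ?_⟩
    have e0 : (x - lat (m + k, n + l)) 0 = √3 * (a - k - l / 2) := by
      rw [PiLp.sub_apply, lat_apply_zero, ha]; push_cast; field_simp; ring
    have e1 : (x - lat (m + k, n + l)) 1 = b - 3 / 2 * l := by
      rw [PiLp.sub_apply, lat_apply_one, hb]; push_cast; ring
    refine mem_hexagon ?_ ?_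
    · rw [e0, abs_mul, abs_of_pos hs]
      nlinarith
    · rw [e0, e1, abs_mul, abs_of_pos hs, mul_div_cancel_left₀ _ hs.ne']
      exact h3
  by_cases hc : |b| + |a| ≤ 1
  · exact key 0 0 (by simpa [abs_le] using h0) (by simpa using hc)
  · rw [not_le] at hc
    rcases abs_cases a with ⟨ea, ha'⟩ | ⟨ea, ha'⟩ <;>
      rcases abs_cases b with ⟨eb, hb'⟩ | ⟨eb, hb'⟩ <;>
      rw [ea, eb] at hc
    · refine key 0 1 ?_ ?_ <;> push_cast
      · rw [abs_le]; constructor <;> linarith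
      · rw [abs_of_nonpos (by linarith), abs_of_nonpos (by linarith)]; linarith
    · refine key 1 (-1) ?_ ?_ <;> push_cast
      · rw [abs_le]; constructor <;> linarith
      · rw [abs_of_nonneg (by linarith), abs_of_nonpos (by linarith)]; linarith
    · refine key (-1) 1 ?_ ?_ <;> push_cast
      · rw [abs_le]; constructor <;> linarith
      · rw [abs_of_nonpos (by linarith), abs_of_nonneg (by linarith)]; linarith
    · refine key 0 (-1) ?_ ?_ <;> push_cast
      · rw [abs_le]; constructor <;> linarith
      · rw [abs_of_nonneg (by linarith), abs_of_nonneg (by linarith)]; linarith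

/-! ### Slices, interiors and frontiers of the bodies -/

/-- The horizontal slice of `body Ω v` at the orientation `θ`. -/
def slice (Ω : Set Plane) (θ : ℝ) (v : Plane) : Set Plane :=
  rot (Real.pi + θ) '' Ω + hexagonAt v

section Bodies

variable {Ω : Set Plane}

lemma mem_body_iff_mem_slice {q : Config} {v : Plane} :
    q ∈ body Ω v ↔ q.1 ∈ slice Ω q.2 v := Iff.rfl

lemma mem_slice {θ : ℝ} {x v : Plane} :
    x ∈ slice Ω θ v ↔ ∃ w ∈ Ω, ∃ h ∈ hexagon, x = rot (Real.pi + θ) w + (v + h) := by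
  simp only [slice, hexagonAt, singleton_add, Set.mem_add, mem_image, exists_exists_and_eq_and,
    eq_comm (a := x)]

lemma norm_le_of_mem_slice (hcomp : IsCompact Ω) (h0 : (0 : Plane) ∈ Ω) {θ : ℝ} {x v : Plane}
    (hx : x ∈ slice Ω θ v) : ‖v‖ ≤ ‖x‖ + Metric.diam Ω + 1 := by
  obtain ⟨w, hw, h, hh, rfl⟩ := mem_slice.1 hx
  have h1 : ‖w‖ ≤ Metric.diam Ω := by
    simpa using Metric.dist_le_diam_of_mem hcomp.isBounded hw h0
  have h2 := norm_le_one_of_mem_hexagon hh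
  set r := rot (Real.pi + θ) w with hr
  have h3 : ‖r‖ = ‖w‖ := norm_rot _ _
  calc ‖v‖ = ‖(r + (v + h)) - r - h‖ := by congr 1; abel
    _ ≤ ‖(r + (v + h)) - r‖ + ‖h‖ := norm_sub_le _ _
    _ ≤ ‖r + (v + h)‖ + ‖r‖ + ‖h‖ := by gcongr; exact norm_sub_le _ _
    _ ≤ _ := by rw [h3]; gcongr

lemma convex_slice (hconv : Convex ℝ Ω) (θ : ℝ) (v : Plane) : Convex ℝ (slice Ω θ v) :=
  (hconv.linear_image (rotLinear (Real.pi + θ))).add ((convex_singleton v).add convex_hexagon)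

lemma isCompact_slice (hcomp : IsCompact Ω) (θ : ℝ) (v : Plane) : IsCompact (slice Ω θ v) :=
  (hcomp.image (continuous_rot continuous_const continuous_id)).add
    (isCompact_singleton.add isCompact_hexagon)

lemma isClosed_body (hcomp : IsCompact Ω) (v : Plane) : IsClosed (body Ω v) := by
  have h1 : IsCompact ((univ : Set (Icc (0 : ℝ) (Real.pi / 3))) ×ˢ (Ω ×ˢ hexagon)) :=
    isCompact_univ.prod (hcomp.prod isCompact_hexagon)
  have h2 : Continuous fun a : Icc (0 : ℝ) (Real.pi / 3) × (Plane × Plane) =>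
      ((rot (Real.pi + (a.1 : ℝ)) a.2.1 + (v + a.2.2), a.1) : Config) := by
    fun_prop
  convert (h1.image h2).isClosed using 1
  ext ⟨x, θ⟩
  rw [mem_body_iff_mem_slice, mem_slice]
  constructor
  · rintro ⟨w, hw, h, hh, hx⟩
    exact ⟨(θ, w, h), ⟨mem_univ _, hw, hh⟩, Prod.ext hx.symm rfl⟩
  · rintro ⟨⟨θ', w, h⟩, ⟨-, hw, hh⟩, he⟩
    obtain ⟨hx, rfl⟩ := Prod.ext_iff.1 he
    exact ⟨w, hw, h, hh, hx.symm⟩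

lemma mem_interior_body_of_mem_interior {q : Config} {v w h : Plane} (hw : w ∈ interior Ω)
    (hh : h ∈ hexagon) (hq : q.1 = rot (Real.pi + (q.2 : ℝ)) w + (v + h)) :
    q ∈ interior (body Ω v) := by
  have hc : Continuous fun q : Config => rot (-(Real.pi + (q.2 : ℝ))) (q.1 - (v + h)) := by
    fun_prop
  refine mem_interior.2 ⟨_, ?_, (isOpen_interior (s := Ω)).preimage hc, ?_⟩
  · intro q' hq'
    rw [mem_body_iff_mem_slice, mem_slice]
    refine ⟨_, interior_subset hq', h, hh, ?_⟩
    rw [rot_rot_neg]; abel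
  · rw [mem_preimage, hq, add_sub_cancel_right, rot_neg_rot]
    exact hw

lemma mem_interior_slice_of_mem_interior_body {q : Config} {v : Plane}
    (hq : q ∈ interior (body Ω v)) : q.1 ∈ interior (slice Ω q.2 v) := by
  have hc : Continuous fun x : Plane => ((x, q.2) : Config) := by fun_prop
  exact mem_interior.2 ⟨_, fun x hx => mem_body_iff_mem_slice.1 (interior_subset hx),
    isOpen_interior.preimage hc, hq⟩

/-- Pushing an interior point of a slice slightly outwards and combining the result with an
interior point of `Ω` shows that it is the sum of a rotated interior point of `Ω` and a point of
the hexagon. -/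
lemma exists_mem_interior_of_mem_interior_slice (hconv : Convex ℝ Ω)
    (hint : (interior Ω).Nonempty) {θ : ℝ} {x v : Plane} (hx : x ∈ interior (slice Ω θ v)) :
    ∃ w ∈ interior Ω, ∃ h ∈ hexagon, x = rot (Real.pi + θ) w + (v + h) := by
  obtain ⟨a, ha⟩ := hint
  obtain ⟨t, ht, ht0⟩ := ((eventually_add_smul_mem (mem_interior_iff_mem_nhds.1 hx)
    (x - (rot (Real.pi + θ) a + v))).and self_mem_nhdsWithin).exists
  replace ht0 : 0 < t := ht0
  obtain ⟨w, hw, h, hh, he⟩ := mem_slice.1 ht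
  have h1 : (0 : ℝ) < 1 + t := by positivity
  have hz : (0 : Plane) ∈ hexagon := interior_subset zero_mem_interior_hexagon
  have hsum : t / (1 + t) + 1 / (1 + t) = 1 := by field_simp; ring
  refine ⟨_, hconv.combo_interior_self_mem_interior ha hw (a := t / (1 + t)) (b := 1 / (1 + t))
    (by positivity) (by positivity) hsum, _, convex_hexagon hz hh (a := t / (1 + t))
    (b := 1 / (1 + t)) (by positivity) (by positivity) hsum, ?_⟩
  rw [← rotLinear_apply, map_add, map_smul, map_smul, rotLinear_apply, rotLinear_apply]
  set r := rot (Real.pi + θ) w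
  set s := rot (Real.pi + θ) a
  have h2 : x = (1 / (1 + t)) • (x + t • (x - (s + v))) + (t / (1 + t)) • (s + v) := by
    match_scalars <;> field_simp <;> ring
  rw [he] at h2
  rw [h2]
  match_scalars <;> field_simp

lemma mem_interior_body_iff (hconv : Convex ℝ Ω) (hint : (interior Ω).Nonempty) {q : Config}
    {v : Plane} : q ∈ interior (body Ω v) ↔
      ∃ w ∈ interior Ω, ∃ h ∈ hexagon, q.1 = rot (Real.pi + (q.2 : ℝ)) w + (v + h) :=
  ⟨fun h => exists_mem_interior_of_mem_interior_slice hconv hint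
    (mem_interior_slice_of_mem_interior_body h),
    fun ⟨_, hw, _, hh, hq⟩ => mem_interior_body_of_mem_interior hw hh hq⟩

lemma mem_interior_body_iff_mem_interior_slice (hconv : Convex ℝ Ω)
    (hint : (interior Ω).Nonempty) {q : Config} {v : Plane} :
    q ∈ interior (body Ω v) ↔ q.1 ∈ interior (slice Ω q.2 v) :=
  ⟨mem_interior_slice_of_mem_interior_body, fun h => (mem_interior_body_iff hconv hint).2
    (exists_mem_interior_of_mem_interior_slice hconv hint h)⟩

lemma mem_frontier_body_iff_mem_frontier_slice (hconv : Convex ℝ Ω) (hcomp : IsCompact Ω)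
    (hint : (interior Ω).Nonempty) {q : Config} {v : Plane} :
    q ∈ frontier (body Ω v) ↔ q.1 ∈ frontier (slice Ω q.2 v) := by
  rw [(isClosed_body hcomp v).frontier_eq, (isCompact_slice hcomp q.2 v).isClosed.frontier_eq,
    Set.mem_sdiff, Set.mem_sdiff, mem_interior_body_iff_mem_interior_slice hconv hint,
    mem_body_iff_mem_slice]

lemma mem_slice_sub {θ : ℝ} {x v u : Plane} :
    x - u ∈ slice Ω θ (v - u) ↔ x ∈ slice Ω θ v := by
  simp only [mem_slice]
  refine exists_congr fun w => and_congr_right fun _ => exists_congr fun h =>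
    and_congr_right fun _ => ?_
  rw [sub_eq_iff_eq_add]
  congr! 1
  abel

lemma mem_interior_body_sub (hconv : Convex ℝ Ω) (hint : (interior Ω).Nonempty) {q : Config}
    {v u : Plane} : (q.1 - u, q.2) ∈ interior (body Ω (v - u)) ↔ q ∈ interior (body Ω v) := by
  simp only [mem_interior_body_iff hconv hint]
  refine exists_congr fun w => and_congr_right fun _ => exists_congr fun h =>
    and_congr_right fun _ => ?_
  rw [sub_eq_iff_eq_add]
  congr! 1
  abel

lemma mem_frontier_body_sub (hconv : Convex ℝ Ω) (hcomp : IsCompact Ω)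
    (hint : (interior Ω).Nonempty) {q : Config} {v u : Plane} :
    (q.1 - u, q.2) ∈ frontier (body Ω (v - u)) ↔ q ∈ frontier (body Ω v) := by
  rw [(isClosed_body hcomp _).frontier_eq, (isClosed_body hcomp v).frontier_eq,
    Set.mem_sdiff, Set.mem_sdiff, mem_interior_body_sub hconv hint, mem_body_iff_mem_slice,
    mem_body_iff_mem_slice, mem_slice_sub]

lemma nonempty_interior_slice (hconv : Convex ℝ Ω) (hint : (interior Ω).Nonempty)
    (θ : Icc (0 : ℝ) (Real.pi / 3)) (v : Plane) : (interior (slice Ω θ v)).Nonempty := by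
  obtain ⟨a, ha⟩ := hint
  exact ⟨_, (mem_interior_body_iff_mem_interior_slice hconv ⟨a, ha⟩
    (q := (rot (Real.pi + (θ : ℝ)) a + (v + 0), θ))).1 (mem_interior_body_of_mem_interior ha
      (interior_subset zero_mem_interior_hexagon) rfl)⟩

/-- Bodies that belong to adjacent hexagons overlap in every slice. -/
lemma interior_slice_inter_interior_slice_nonempty (hint : (interior Ω).Nonempty)
    (θ : Icc (0 : ℝ) (Real.pi / 3)) (i : ℤ × ℤ) :
    (interior (slice Ω θ (lat i)) ∩ interior (slice Ω θ (lat (i - (1, 0))))).Nonempty := by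
  obtain ⟨a, ha⟩ := hint
  -- The midpoint of the right side; its negative is the midpoint of the left side.
  have hh : (!₂[√3 / 2, 0] : Plane) ∈ hexagon := by
    refine mem_hexagon (by simpa using (abs_of_nonneg (by positivity)).le) ?_
    have hs : (0 : ℝ) < √3 := by positivity
    simp only [Matrix.cons_val_zero, Matrix.cons_val_one,
      Matrix.cons_val_fin_one, abs_zero, zero_add]
    rw [abs_of_nonneg (by positivity), div_div_cancel_left' hs.ne']
    norm_num
  refine ⟨rot (Real.pi + (θ : ℝ)) a + (lat i + -!₂[√3 / 2, 0]), ?_, ?_⟩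
  · exact mem_interior_slice_of_mem_interior_body (q := (_, θ))
      (mem_interior_body_of_mem_interior ha (neg_mem_hexagon hh) rfl)
  · refine mem_interior_slice_of_mem_interior_body (q := (_, θ))
      (mem_interior_body_of_mem_interior ha hh ?_)
    have h1 : lat (1, 0) = !₂[√3 / 2, 0] + !₂[√3 / 2, 0] := by
      ext k; fin_cases k
      · simp [lat_apply_zero]
      · simp [lat_apply_one]
    simp only [lat_sub, h1]
    abel

lemma locallyFinite_body (hcomp : IsCompact Ω) (h0 : (0 : Plane) ∈ Ω) :
    LocallyFinite fun i => body Ω (lat i) := by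
  intro q
  refine ⟨Prod.fst ⁻¹' Metric.ball q.1 1,
    continuous_fst.continuousAt.preimage_mem_nhds (Metric.ball_mem_nhds _ one_pos),
    (finite_norm_lat_le (‖q.1‖ + 1 + Metric.diam Ω + 1)).subset ?_⟩
  rintro i ⟨y, hy, hyq⟩
  have h1 := norm_le_of_mem_slice hcomp h0 (mem_body_iff_mem_slice.1 hy)
  have h2 : ‖y.1‖ ≤ ‖q.1‖ + 1 := by
    have h3 : dist y.1 q.1 < 1 := hyq
    rw [dist_eq_norm] at h3
    linarith [norm_sub_norm_le y.1 q.1]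
  exact h1.trans (by linarith)

lemma lat_mem_closedBall_of_mem_body (hcomp : IsCompact Ω) (h0 : (0 : Plane) ∈ Ω) {q : Config}
    (hq : q ∈ prism) {i : ℤ × ℤ} (hi : q ∈ body Ω (lat i)) :
    lat i ∈ Metric.closedBall (0 : Plane) (Metric.diam Ω + 3) := by
  rw [mem_closedBall_zero_iff]
  linarith [norm_le_of_mem_slice hcomp h0 (mem_body_iff_mem_slice.1 hi),
    norm_le_one_of_mem_hexagon hq]

lemma body_lat_mem_bodies (hcomp : IsCompact Ω) (h0 : (0 : Plane) ∈ Ω) {q : Config}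
    (hq : q ∈ prism) {i : ℤ × ℤ} (hi : q ∈ body Ω (lat i)) : body Ω (lat i) ∈ bodies Ω :=
  ⟨i.1, i.2, lat_mem_closedBall_of_mem_body hcomp h0 hq hi, rfl⟩

lemma frontier_body_injective (hconv : Convex ℝ Ω) (hcomp : IsCompact Ω)
    (hint : (interior Ω).Nonempty) : Function.Injective fun v => frontier (body Ω v) := by
  intro v u h
  simp only at h
  by_contra hne
  have h0 : (0 : ℝ) ∈ Icc (0 : ℝ) (Real.pi / 3) := ⟨le_rfl, by positivity⟩
  obtain ⟨y, hy, hyn⟩ := exists_mem_frontier_add_notMem (isCompact_slice hcomp 0 v)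
    ((nonempty_interior_slice hconv hint ⟨0, h0⟩ v).mono interior_subset)
    (sub_ne_zero.2 (Ne.symm hne))
  have h1 : ((y, ⟨0, h0⟩) : Config) ∈ frontier (body Ω v) :=
    (mem_frontier_body_iff_mem_frontier_slice hconv hcomp hint).2 hy
  rw [← mem_frontier_body_sub hconv hcomp hint (u := v - u), sub_sub_cancel, ← h] at h1
  refine hyn ?_
  simpa [sub_eq_add_neg] using
    mem_body_iff_mem_slice.1 ((isClosed_body hcomp v).frontier_subset h1)

lemma N_eq_encard_interiorIndices (hconv : Convex ℝ Ω) (hcomp : IsCompact Ω)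
    (hint : (interior Ω).Nonempty) (h0 : (0 : Plane) ∈ Ω) {q : Config} (hq : q ∈ prism) :
    N Ω q = (interiorIndices (fun i => body Ω (lat i)) q).encard := by
  have hinj : Function.Injective fun i => body Ω (lat i) := fun i j h =>
    lat_injective (frontier_body_injective hconv hcomp hint (congrArg frontier h))
  rw [← hinj.encard_image, N]
  congr 1
  ext T
  constructor
  · rintro ⟨⟨m, n, -, rfl⟩, hT⟩
    exact ⟨(m, n), hT, rfl⟩
  · rintro ⟨i, hi, rfl⟩
    exact ⟨body_lat_mem_bodies hcomp h0 hq (interior_subset (s := body Ω (lat i)) hi), hi⟩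

/-- The covering number by the bodies of all lattice points is periodic. -/
lemma encard_interiorIndices_sub (hconv : Convex ℝ Ω) (hint : (interior Ω).Nonempty)
    (q : Config) (a : ℤ × ℤ) :
    (interiorIndices (fun i => body Ω (lat i)) (q.1 - lat a, q.2)).encard =
      (interiorIndices (fun i => body Ω (lat i)) q).encard := by
  rw [← (Equiv.subRight a).injective.encard_image (interiorIndices _ q)]
  congr 1
  ext i
  rw [Equiv.image_eq_preimage_symm]
  simp only [interiorIndices, mem_ofPred_eq, mem_preimage, Equiv.subRight_symm_apply]
  rw [← mem_interior_body_sub hconv hint (q := q) (u := lat a), ← lat_sub, add_sub_cancel_right]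

end Bodies

/-! ### The boundary of the prism -/

lemma mem_prismBoundary_of_eq {q : Config} (hq : q ∈ prism) (h : (q.2 : ℝ) = Real.pi / 3) :
    q ∈ prismBoundary := by
  have h0 : (0 : ℝ) ≤ Real.pi / 3 := by positivity
  refine mem_ofPred.2 ?_
  rw [frontier_prod_eq, frontier_Icc h0]
  exact Or.inl ⟨subset_closure hq, by simp [h]⟩

/-- The bottom face of the prism has interior points, unlike a slice of a body's frontier. -/
lemma prismBoundary_ne_frontier_body {Ω : Set Plane} (hconv : Convex ℝ Ω) (hcomp : IsCompact Ω)
    (hint : (interior Ω).Nonempty) (v : Plane) : prismBoundary ≠ frontier (body Ω v) := by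
  intro h
  have h0 : (0 : ℝ) ≤ Real.pi / 3 := by positivity
  have h1 : hexagon ⊆ frontier (slice Ω 0 v) := by
    intro x hx
    have h2 : ((x, ⟨0, le_rfl, h0⟩) : Config) ∈ prismBoundary := by
      refine mem_ofPred.2 ?_
      rw [frontier_prod_eq, frontier_Icc h0]
      exact Or.inl ⟨subset_closure hx, by simp⟩
    rw [h] at h2
    exact (mem_frontier_body_iff_mem_frontier_slice hconv hcomp hint
      (q := (x, ⟨0, le_rfl, h0⟩))).1 h2
  have h3 := interior_mono h1 zero_mem_interior_hexagon
  rw [interior_frontier (isCompact_slice hcomp 0 v).isClosed] at h3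
  exact h3

/-! ### Raising the orientation -/

/-- At a crossing of two overlapping bodies through which no third boundary passes, the
orientation can be increased without increasing the covering number: pushing the crossing away
from a common interior point of the two slices leaves both bodies, and this persists for slightly
larger orientations. -/
lemma exists_gt_encard_interiorIndices_le {Ω : Set Plane} (hconv : Convex ℝ Ω)
    (hcomp : IsCompact Ω) (hint : (interior Ω).Nonempty) (h0 : (0 : Plane) ∈ Ω) {q : Config}
    (hq : (q.2 : ℝ) < Real.pi / 3) {i j : ℤ × ℤ} (hi : q ∈ frontier (body Ω (lat i)))
    (hj : q ∈ frontier (body Ω (lat j)))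
    (hij : (interior (slice Ω q.2 (lat i)) ∩ interior (slice Ω q.2 (lat j))).Nonempty)
    (hl : ∀ l, q ∈ frontier (body Ω (lat l)) → l = i ∨ l = j) :
    ∃ y : Config, q.2 < y.2 ∧ (interiorIndices (fun i => body Ω (lat i)) y).encard ≤
      (interiorIndices (fun i => body Ω (lat i)) q).encard := by
  obtain ⟨c, hci, hcj⟩ := hij
  have hout : ∀ k, c ∈ interior (slice Ω q.2 (lat k)) → q ∈ frontier (body Ω (lat k)) →
      ∀ t : ℝ, 0 < t → (q.1 + t • (q.1 - c), q.2) ∉ body Ω (lat k) := fun k hc hk t ht =>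
    add_smul_sub_notMem_of_notMem_interior (convex_slice hconv q.2 (lat k)) hc
      ((mem_frontier_body_iff_mem_frontier_slice hconv hcomp hint).1 hk).2 ht
  have hev := (eventually_interiorIndices_subset_of_frontier (locallyFinite_body hcomp h0)
    (fun k => isClosed_body hcomp (lat k)) q).eventually_nhds
  have hpush : Tendsto (fun x : Plane => ((x, q.2) : Config)) (𝓝 q.1) (𝓝 q) :=
    (by fun_prop : Continuous fun x : Plane => ((x, q.2) : Config)).tendsto q.1
  obtain ⟨t, ht, ht0⟩ := ((eventually_add_smul_mem (hpush.eventually hev) (q.1 - c)).and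
    self_mem_nhdsWithin).exists
  set x := q.1 + t • (q.1 - c) with hx
  have hraise : Tendsto (fun θ : Icc (0 : ℝ) (Real.pi / 3) => ((x, θ) : Config)) (𝓝[>] q.2)
      (𝓝 (x, q.2)) :=
    ((by fun_prop : Continuous fun θ : Icc (0 : ℝ) (Real.pi / 3) => ((x, θ) : Config)).tendsto
      q.2).mono_left nhdsWithin_le_nhds
  have hne : (𝓝[>] q.2).NeBot :=
    nhdsGT_neBot_of_exists_gt ⟨⟨Real.pi / 3, by positivity, le_rfl⟩, hq⟩
  obtain ⟨θ, ⟨⟨hθ, hθi⟩, hθj⟩, hθq⟩ := (((hraise.eventually ht).and (hraise.eventually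
    ((isClosed_body hcomp (lat i)).isOpen_compl.mem_nhds (hout i hci hi t ht0)))).and
    (hraise.eventually ((isClosed_body hcomp (lat j)).isOpen_compl.mem_nhds
      (hout j hcj hj t ht0)))).and self_mem_nhdsWithin |>.exists
  refine ⟨(x, θ), hθq, encard_le_encard (hθ fun l hlq hlx => ?_)⟩
  rcases hl l hlq with rfl | rfl
  · exact hθi (interior_subset hlx)
  · exact hθj (interior_subset hlx)

/-- Among the points of the prism with covering number at most that of `p`, one with the largest
orientation leads to a crossing in the same slice; by maximality, a third boundary passes through
it unless the orientation is `π / 3`. -/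
theorem exists_crossing_of_bodies {Ω : Set Plane} (hconv : Convex ℝ Ω)
    (hcomp : IsCompact Ω) (hint : (interior Ω).Nonempty) (h0 : (0 : Plane) ∈ Ω) {p : Config}
    (hp : p ∈ prism) :
    ∃ q ∈ prism, (interiorIndices (fun i => body Ω (lat i)) q).encard ≤
      (interiorIndices (fun i => body Ω (lat i)) p).encard ∧ ∃ i j, i ≠ j ∧
      q ∈ frontier (body Ω (lat i)) ∧ q ∈ frontier (body Ω (lat j)) ∧
      ((q.2 : ℝ) = Real.pi / 3 ∨ ∃ l, i ≠ l ∧ j ≠ l ∧ q ∈ frontier (body Ω (lat l))) := by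
  set T : ℤ × ℤ → Set Config := fun i => body Ω (lat i) with hT
  have hprism : IsCompact prism := by
    have : prism = hexagon ×ˢ univ := by ext q; simp [prism]
    rw [this]
    exact isCompact_hexagon.prod isCompact_univ
  have hA := hprism.inter_right (isClosed_encard_interiorIndices_le (locallyFinite_body hcomp h0)
    (interiorIndices T p).encard)
  obtain ⟨q₀, ⟨-, hq₀⟩, hmax⟩ := hA.exists_isMaxOn ⟨p, hp, le_refl (interiorIndices T p).encard⟩
    (f := fun q : Config => q.2) (by fun_prop)
  set θ := q₀.2 with hθ
  have hslice : ∀ x, interiorIndices (fun i => slice Ω θ (lat i)) x = interiorIndices T (x, θ) :=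
    fun x => Set.ext fun i =>
      (mem_interior_body_iff_mem_interior_slice hconv hint (q := (x, θ))).symm
  have hrank : 1 < Module.rank ℝ Plane := by
    rw [← Module.finrank_eq_rank, finrank_euclideanSpace_fin]; norm_num
  have hlf : LocallyFinite fun i => slice Ω θ (lat i) :=
    (locallyFinite_body hcomp h0).preimage_continuous
      (by fun_prop : Continuous fun x : Plane => ((x, θ) : Config))
  obtain ⟨x, hx, i, j, hij, hi, hj, hcase⟩ := exists_crossing hrank hlf
    (fun i => convex_slice hconv θ (lat i)) (fun i => isCompact_slice hcomp θ (lat i))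
    (fun i => nonempty_interior_slice hconv hint θ (lat i)) (fun i => by
      have hover := interior_slice_inter_interior_slice_nonempty hint θ i
      have hne : lat i - lat (i - (1, 0)) ≠ 0 := sub_ne_zero.2 fun h => by
        have h1 := congrArg Prod.fst (lat_injective h)
        rw [Prod.fst_sub] at h1
        omega
      refine ⟨i - (1, 0), fun h => hne (by rw [← h, sub_self]), ?_, hover⟩
      refine frontier_inter_frontier_nonempty hrank (neg_ne_zero.2 hne) (fun y => ?_)
        (convex_slice hconv θ _) (isCompact_slice hcomp θ _) (convex_slice hconv θ _)
        (isCompact_slice hcomp θ _) hover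
      rw [← mem_slice_sub (u := -(lat i - lat (i - (1, 0))))]
      simp) q₀.1
  rw [hslice, hslice] at hx
  have hxk : (interiorIndices T (x, θ)).encard ≤ (interiorIndices T p).encard := hx.trans hq₀
  have hfr : ∀ l, x ∈ frontier (slice Ω θ (lat l)) → ((x, θ) : Config) ∈ frontier (T l) :=
    fun l hl => (mem_frontier_body_iff_mem_frontier_slice hconv hcomp hint (q := (x, θ))).2 hl
  have htop : (θ : ℝ) = Real.pi / 3 ∨ ∃ l, i ≠ l ∧ j ≠ l ∧ ((x, θ) : Config) ∈ frontier (T l) := by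
    rcases hcase with hover | ⟨l, hil, hjl, hl⟩
    · by_contra! hcon
      obtain ⟨y, hy, hyk⟩ := exists_gt_encard_interiorIndices_le hconv hcomp hint h0
        (q := (x, θ)) (lt_of_le_of_ne θ.2.2 hcon.1) (hfr i hi) (hfr j hj) hover fun l hl => by
          by_contra! hne
          exact hcon.2 l hne.1.symm hne.2.symm hl
      obtain ⟨a, ha⟩ := exists_sub_lat_mem_hexagon y.1
      have hle := hmax (a := (y.1 - lat a, y.2)) ⟨ha,
        (encard_interiorIndices_sub hconv hint y a).le.trans (hyk.trans hxk)⟩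
      exact absurd hy (not_lt.2 hle)
    · exact Or.inr ⟨l, hil, hjl, hfr l hl⟩
  obtain ⟨a, ha⟩ := exists_sub_lat_mem_hexagon x
  have hfr' : ∀ l, ((x, θ) : Config) ∈ frontier (T l) →
      ((x - lat a, θ) : Config) ∈ frontier (body Ω (lat (l - a))) := fun l hl => by
    rw [lat_sub]
    exact (mem_frontier_body_sub hconv hcomp hint (q := (x, θ))).2 hl
  refine ⟨(x - lat a, θ), ha, (encard_interiorIndices_sub hconv hint (x, θ) a).le.trans hxk,
    i - a, j - a, fun h => hij (sub_left_injective h), hfr' i (hfr i hi), hfr' j (hfr j hj), ?_⟩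
  refine htop.imp_right fun ⟨l, hil, hjl, hl⟩ => ⟨l - a, fun h => hil (sub_left_injective h),
    fun h => hjl (sub_left_injective h), hfr' l hl⟩

end HexCover

end

theorem mainTheorem7 (Ω : Set HexCover.Plane) (hconv : Convex ℝ Ω) (hcomp : IsCompact Ω)
    (hint : (interior Ω).Nonempty) (h0 : (0 : HexCover.Plane) ∈ Ω)
    (p : HexCover.Config) (hp : p ∈ HexCover.prism) :
    ∃ q ∈ HexCover.prism, HexCover.N Ω q ≤ HexCover.N Ω p ∧
      (∃ S₁ ∈ HexCover.bodySurfaces Ω ∪ {HexCover.prismBoundary},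
        ∃ S₂ ∈ HexCover.bodySurfaces Ω ∪ {HexCover.prismBoundary},
        ∃ S₃ ∈ HexCover.bodySurfaces Ω ∪ {HexCover.prismBoundary},
          S₁ ≠ S₂ ∧ S₁ ≠ S₃ ∧ S₂ ≠ S₃ ∧ q ∈ S₁ ∩ S₂ ∩ S₃) ∧
      ((∃ T₁ ∈ HexCover.bodies Ω, ∃ T₂ ∈ HexCover.bodies Ω, ∃ T₃ ∈ HexCover.bodies Ω,
          T₁ ≠ T₂ ∧ T₁ ≠ T₃ ∧ T₂ ≠ T₃ ∧ q ∈ frontier T₁ ∩ frontier T₂ ∩ frontier T₃) ∨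
        (∃ T₁ ∈ HexCover.bodies Ω, ∃ T₂ ∈ HexCover.bodies Ω,
          T₁ ≠ T₂ ∧ q ∈ frontier T₁ ∩ frontier T₂ ∩ HexCover.prismBoundary)) := by
  open HexCover in
  obtain ⟨q, hq, hle, i, j, hij, hi, hj, hcase⟩ :=
    exists_crossing_of_bodies hconv hcomp hint h0 hp
  have hbodies : ∀ {l}, q ∈ frontier (body Ω (lat l)) → body Ω (lat l) ∈ bodies Ω := fun hl =>
    body_lat_mem_bodies hcomp h0 hq ((isClosed_body hcomp _).frontier_subset hl)
  have hne : ∀ {k l}, k ≠ l → frontier (body Ω (lat k)) ≠ frontier (body Ω (lat l)) :=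
    fun h he => h (lat_injective (frontier_body_injective hconv hcomp hint he))
  have hne' : ∀ {k l}, k ≠ l → body Ω (lat k) ≠ body Ω (lat l) := fun h he =>
    hne h (congrArg frontier he)
  refine ⟨q, hq, ?_, ?_⟩
  · rwa [N_eq_encard_interiorIndices hconv hcomp hint h0 hq,
      N_eq_encard_interiorIndices hconv hcomp hint h0 hp]
  rcases hcase with htop | ⟨l, hil, hjl, hl⟩
  · have hqb := mem_prismBoundary_of_eq hq htop
    exact ⟨⟨_, Or.inl ⟨_, hbodies hi, rfl⟩, _, Or.inl ⟨_, hbodies hj, rfl⟩, _, Or.inr rfl,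
      hne hij, (prismBoundary_ne_frontier_body hconv hcomp hint _).symm,
      (prismBoundary_ne_frontier_body hconv hcomp hint _).symm, ⟨hi, hj⟩, hqb⟩,
      Or.inr ⟨_, hbodies hi, _, hbodies hj, hne' hij, ⟨hi, hj⟩, hqb⟩⟩
  · exact ⟨⟨_, Or.inl ⟨_, hbodies hi, rfl⟩, _, Or.inl ⟨_, hbodies hj, rfl⟩, _,
      Or.inl ⟨_, hbodies hl, rfl⟩, hne hij, hne hil, hne hjl, ⟨hi, hj⟩, hl⟩,
      Or.inl ⟨_, hbodies hi, _, hbodies hj, _, hbodies hl, hne' hij, hne' hil, hne' hjl,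
        ⟨hi, hj⟩, hl⟩⟩
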